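/- Let $A$ be a (complex, not necessarily unital) $C^*$-algebra. Let $\mathrm{Prim}(A)$ be the set of primitive ideals of $A$ (the kernels of the irreducible $*$-representations of $A$ on Hilbert spaces) with the hull-kernel topology. For $P_1,P_2\in\mathrm{Prim}(A)$ write $P_1\approx P_2$ if $f(P_1)=f(P_2)$ for every bounded continuous function $f:\mathrm{Prim}(A)\to\mathbb{R}$. Let $\mathrm{Glimm}(A)$ be the set of the kernels (intersections) of the $\approx$-classes, identified with $\mathrm{Prim}(A)/{\approx}$, and let $q_A:\mathrm{Prim}(A)\to\mathrm{Glimm}(A)$ be the quotient map. Let $\tau_q$ be the quotient topology on $\mathrm{Glimm}(A)$, and let $\tau_{cr}$ be the weakest topology on $\mathrm{Glimm}(A)$ for which all the functions on $\mathrm{Glimm}(A)$ induced by the bounded continuous real functions on $\mathrm{Prim}(A)$ are continuous. For $a\in A$ and $G\in\mathrm{Glimm}(A)$ let $\|a+G\|$ be the norm of the image of $a$ in $A/G$. (1) If $q_A$ is an open map (for $\tau_q$), then for every $\tau_{cr}$-compact $K\subset\mathrm{Glimm}(A)$ there exist $a\in A$ and $\alpha>0$ such that $$K\subset\{G\in\mathrm{Glimm}(A)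 : \|a+G\|\ge\alpha\}.$$ (2) This applies to quasi-standard $C^*$-algebras: let $P\sim Q$ mean that $P,Q\in\mathrm{Prim}(A)$ cannot be separated by disjoint open subsets of $\mathrm{Prim}(A)$, and call $A$ quasi-standard if $\sim$ is an open equivalence relation, that is, an equivalence relation for which the saturation of every open subset of $\mathrm{Prim}(A)$ is open. If $A$ is quasi-standard, then $q_A$ is open (for $\tau_q$), and hence every $\tau_{cr}$-compact $K\subset\mathrm{Glimm}(A)$ is contained in a set $\{G\in\mathrm{Glimm}(A) : \|a+G\|\ge\alpha\}$ with $a\in A$ and $\alpha>0$. -/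

import Mathlib

open scoped BoundedContinuousFunction

namespace CStarGlimm

universe u

/-- A `*`-representation `π` of `A` on the Hilbert space `H` is irreducible if it is nonzero and the
only closed subspaces of `H` invariant under `π(A)` are `0` and `H`. -/
def IsIrreducibleRep {A : Type u} [NonUnitalCStarAlgebra A] {H : Type u}
    [NormedAddCommGroup H] [InnerProductSpace ℂ H] [CompleteSpace H]
    (π : A →⋆ₙₐ[ℂ] (H →L[ℂ] H)) : Prop :=
  (∃ a : A, π a ≠ 0) ∧
    ∀ M : Submodule ℂ H, IsClosed (M : Set H) → (∀ a : A, ∀ v ∈ M, π a v ∈ M) → M = ⊥ ∨ M = ⊤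

/-- A primitive ideal is the kernel of an irreducible `*`-representation on a Hilbert space. An
irreducible representation is generated by any nonzero vector, hence is unitarily equivalent to one
on a space in the universe of `A`, so the universe of `H` is no restriction. -/
def IsPrimitive {A : Type u} [NonUnitalCStarAlgebra A] (P : TwoSidedIdeal A) : Prop :=
  ∃ (H : Type u) (_ : NormedAddCommGroup H) (_ : InnerProductSpace ℂ H) (_ : CompleteSpace H)
    (π : A →⋆ₙₐ[ℂ] (H →L[ℂ] H)), IsIrreducibleRep π ∧ P = TwoSidedIdeal.ker π

/-- The set `Prim(A)` of primitive ideals of `A`. -/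
def PrimSpace (A : Type u) [NonUnitalCStarAlgebra A] : Type u :=
  {P : TwoSidedIdeal A // IsPrimitive P}

/-- The hull of an ideal `I`: the primitive ideals that contain `I`. -/
def hull {A : Type u} [NonUnitalCStarAlgebra A] (I : TwoSidedIdeal A) : Set (PrimSpace A) :=
  {P | I ≤ P.1}

/-- The kernel of a set of primitive ideals: their intersection. -/
def kernel {A : Type u} [NonUnitalCStarAlgebra A] (W : Set (PrimSpace A)) : TwoSidedIdeal A :=
  sInf (Subtype.val '' W)

theorem IsPrimitive.ne_top {A : Type u} [NonUnitalCStarAlgebra A] {P : TwoSidedIdeal A}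
    (hP : IsPrimitive P) : P ≠ ⊤ := by
  obtain ⟨H, _, _, _, π, ⟨⟨a, ha⟩, -⟩, rfl⟩ := hP
  intro h
  have : a ∈ TwoSidedIdeal.ker π := by rw [h]; trivial
  exact ha ((TwoSidedIdeal.mem_ker π).1 this)

theorem IsPrimitive.mem_or_mem {A : Type u} [NonUnitalCStarAlgebra A] {P : TwoSidedIdeal A}
    (hP : IsPrimitive P) {s t : A} (h : ∀ a : A, s * a * t ∈ P) : s ∈ P ∨ t ∈ P := by
  obtain ⟨H, _, _, _, π, ⟨⟨c, hc⟩, hirr⟩, rfl⟩ := hP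
  simp only [TwoSidedIdeal.mem_ker] at h ⊢
  by_contra hcon
  push Not at hcon
  obtain ⟨hs, ht⟩ := hcon
  obtain ⟨v, hv⟩ : ∃ v, π t v ≠ 0 := by
    by_contra! h0
    exact ht (ContinuousLinearMap.ext h0)
  -- two closed invariant subspaces: `π(A) w = 0`, and `π(s) π(A) w = 0`
  let N : Submodule ℂ H := ⨅ a : A, LinearMap.ker (π a : H →ₗ[ℂ] H)
  let M : Submodule ℂ H := ⨅ a : A, LinearMap.ker ((π s * π a : H →L[ℂ] H) : H →ₗ[ℂ] H)
  have memN : ∀ w, w ∈ N ↔ ∀ a, π a w = 0 := fun w => by simp [N, Submodule.mem_iInf]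
  have memM : ∀ w, w ∈ M ↔ ∀ a, π s (π a w) = 0 := fun w => by simp [M, Submodule.mem_iInf]
  have clN : IsClosed (N : Set H) := by
    have : (N : Set H) = ⋂ a : A, {w | π a w = 0} := by
      ext w; simp [memN]
    rw [this]
    exact isClosed_iInter fun a => isClosed_eq (π a).continuous continuous_const
  have clM : IsClosed (M : Set H) := by
    have : (M : Set H) = ⋂ a : A, {w | π s (π a w) = 0} := by
      ext w; simp [memM]
    rw [this]
    exact isClosed_iInter fun a =>
      isClosed_eq ((π s).continuous.comp (π a).continuous) continuous_const
  have hN : N = ⊥ := by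
    refine (hirr N clN fun a w hw => ?_).resolve_right fun hT => ?_
    · rw [(memN w).1 hw a]; exact N.zero_mem
    · refine hc (ContinuousLinearMap.ext fun w => ?_)
      exact (memN w).1 (hT ▸ Submodule.mem_top) c
  have hM : M = ⊤ := by
    refine (hirr M clM fun a w hw => ?_).resolve_left fun hB => ?_
    · refine (memM _).2 fun b => ?_
      have := (memM w).1 hw (b * a)
      simpa using this
    · have : π t v ∈ M := (memM _).2 fun a => by
        have := congrArg (fun T : H →L[ℂ] H => T v) (h a)
        simpa using this
      rw [hB] at this
      exact hv ((Submodule.mem_bot ℂ).1 this)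
  refine hs (ContinuousLinearMap.ext fun w => ?_)
  have hstar : ∀ (a : A) (x y : H), inner ℂ (π (star a) x) y = inner ℂ x (π a y) := fun a x y => by
    rw [map_star, ContinuousLinearMap.star_eq_adjoint, ContinuousLinearMap.adjoint_inner_left]
  have all : ∀ (a : A) (x : H), π s (π a x) = 0 := fun a x =>
    (memM x).1 (hM ▸ Submodule.mem_top) a
  have hz : ∀ x : H, π (star s) x = 0 := fun x => by
    have : π (star s) x ∈ N := (memN _).2 fun b => by
      rw [← inner_self_eq_zero (𝕜 := ℂ), ← star_star b, hstar, star_star, hstar, all,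
        inner_zero_right]
    rw [hN] at this
    exact (Submodule.mem_bot ℂ).1 this
  have : inner ℂ (π s w) (π s w) = (0 : ℂ) := by
    rw [← hstar, hz, inner_zero_left]
  simpa using this

/-- The hull-kernel topology on `Prim(A)`: the closed sets are exactly the hulls of ideals. -/
instance (A : Type u) [NonUnitalCStarAlgebra A] : TopologicalSpace (PrimSpace A) :=
  TopologicalSpace.ofClosed (Set.range (hull (A := A)))
    ⟨⊤, Set.eq_empty_of_forall_notMem fun P hP => P.2.ne_top (top_le_iff.1 hP)⟩
    (fun 𝒞 h𝒞 => ⟨sSup {I | hull I ∈ 𝒞}, by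
      ext P
      simp only [hull, Set.mem_ofPred_eq, Set.mem_sInter, sSup_le_iff]
      constructor
      · intro hP C hC
        obtain ⟨I, rfl⟩ := h𝒞 hC
        exact hP I hC
      · exact fun hP I hI => hP _ hI⟩)
    (by
      rintro _ ⟨I, rfl⟩ _ ⟨J, rfl⟩
      refine ⟨I ⊓ J, Set.ext fun P => ⟨fun hP => ?_, ?_⟩⟩
      · by_cases hI : I ≤ P.1
        · exact Or.inl hI
        · obtain ⟨s, hsI, hsP⟩ := Set.not_subset.1 hI
          refine Or.inr fun t htJ => (P.2.mem_or_mem fun a => hP ?_).resolve_left hsP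
          exact (TwoSidedIdeal.mem_inf A).2 ⟨I.mul_mem_right _ _ (I.mul_mem_right _ _ hsI),
            J.mul_mem_left _ _ htJ⟩
      · rintro (hP | hP)
        · exact le_trans inf_le_left (show I ≤ P.1 from hP)
        · exact le_trans inf_le_right (show J ≤ P.1 from hP))

theorem isClosed_iff_hull {A : Type u} [NonUnitalCStarAlgebra A] {C : Set (PrimSpace A)} :
    IsClosed C ↔ ∃ I : TwoSidedIdeal A, hull I = C := by
  rw [← isOpen_compl_iff]
  change Cᶜᶜ ∈ Set.range hull ↔ _
  rw [compl_compl, Set.mem_range]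

/-- `P₁ ≈ P₂` if `f(P₁) = f(P₂)` for all bounded continuous real functions `f` on `Prim(A)`. -/
def glimmSetoid (A : Type u) [NonUnitalCStarAlgebra A] : Setoid (PrimSpace A) where
  r P Q := ∀ f : PrimSpace A →ᵇ ℝ, f P = f Q
  iseqv := ⟨fun _ _ => rfl, fun h f => (h f).symm, fun h k f => (h f).trans (k f)⟩

/-- The set `Glimm(A)`, as the quotient `Prim(A)/≈`; a class is identified with the ideal
`Glimm.ideal` (see `Glimm.ideal_injective`). It carries no default topology. -/
def Glimm (A : Type u) [NonUnitalCStarAlgebra A] : Type u := Quotient (glimmSetoid A)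

/-- The quotient map `q_A : Prim(A) → Glimm(A)`. -/
def glimmMap (A : Type u) [NonUnitalCStarAlgebra A] : PrimSpace A → Glimm A :=
  Quotient.mk (glimmSetoid A)

/-- The Glimm ideal of a point of `Glimm(A)`: the kernel of the equivalence class. -/
def Glimm.ideal {A : Type u} [NonUnitalCStarAlgebra A] (G : Glimm A) : TwoSidedIdeal A :=
  kernel (glimmMap A ⁻¹' {G})

/-- The function on `Glimm(A)` to which a bounded continuous function on `Prim(A)` drops. -/
def Glimm.drop {A : Type u} [NonUnitalCStarAlgebra A] (f : PrimSpace A →ᵇ ℝ) : Glimm A → ℝ :=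
  Quotient.lift (s := glimmSetoid A) f (fun _ _ h => h f)

/-- The quotient topology `τ_q` on `Glimm(A)`. -/
@[reducible] def tauQ (A : Type u) [NonUnitalCStarAlgebra A] : TopologicalSpace (Glimm A) :=
  TopologicalSpace.coinduced (glimmMap A) inferInstance

/-- The weakest topology `τ_cr` on `Glimm(A)` that makes all the dropped functions continuous. -/
@[reducible] def tauCR (A : Type u) [NonUnitalCStarAlgebra A] : TopologicalSpace (Glimm A) :=
  ⨅ f : PrimSpace A →ᵇ ℝ, TopologicalSpace.induced (Glimm.drop f) inferInstance

/-- Equivalence classes are closed, so a point of `Glimm(A)` is determined by its ideal. -/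
theorem Glimm.ideal_injective {A : Type u} [NonUnitalCStarAlgebra A] :
    Function.Injective (Glimm.ideal (A := A)) := by
  intro G₁ G₂ h
  induction G₁ using Quotient.inductionOn with | _ P =>
  induction G₂ using Quotient.inductionOn with | _ Q =>
  have hcl : IsClosed {R : PrimSpace A | ∀ f : PrimSpace A →ᵇ ℝ, f R = f Q} := by
    simp only [Set.ofPred_forall]
    exact isClosed_iInter fun f => isClosed_eq f.continuous continuous_const
  obtain ⟨I, hI⟩ := isClosed_iff_hull.1 hcl
  refine Quotient.sound (s := glimmSetoid A) (?_ : P ∈ {R | ∀ f : PrimSpace A →ᵇ ℝ, f R = f Q})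
  rw [← hI]
  have h1 : I ≤ Glimm.ideal (Quotient.mk (glimmSetoid A) Q) := by
    refine le_sInf ?_
    rintro _ ⟨R, hR, rfl⟩
    have : R ∈ hull I := by
      rw [hI]; exact Quotient.exact (s := glimmSetoid A) hR
    exact this
  refine h1.trans (h ▸ sInf_le ⟨P, rfl, rfl⟩)

/-- The norm `‖a + I‖` of the image of `a` in the quotient `A / I`. -/
noncomputable def quotientNorm {A : Type u} [NonUnitalCStarAlgebra A] (a : A)
    (I : TwoSidedIdeal A) : ℝ :=
  ‖(QuotientAddGroup.mk a : A ⧸ AddSubgroup.ofClass I)‖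

/-- `P ∼ Q`: the points `P`, `Q` of `Prim(A)` cannot be separated by disjoint open sets. -/
def NotSeparated {A : Type u} [NonUnitalCStarAlgebra A] (P Q : PrimSpace A) : Prop :=
  ∀ U V : Set (PrimSpace A), IsOpen U → IsOpen V → P ∈ U → Q ∈ V → (U ∩ V).Nonempty

/-- `A` is quasi-standard if `∼` is an open equivalence relation on `Prim(A)`, that is, an
equivalence relation for which the saturation of every open set is open. -/
def IsQuasiStandard (A : Type u) [NonUnitalCStarAlgebra A] : Prop :=
  Equivalence (NotSeparated (A := A)) ∧
    ∀ U : Set (PrimSpace A), IsOpen U → IsOpen {Q | ∃ P ∈ U, NotSeparated P Q}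

end CStarGlimm

/-!
The sets `{P | r < ‖b⋆b + P‖}` are open in `Prim(A)`, and for `0 < r` the sets
`{P | r ≤ ‖b⋆b + P‖}` are compact: given an ultrafilter on such a set, choose quasi-states `F P`
vanishing on `P` with `r ≤ F P (b⋆b)`. Their weak-* limit vanishes on every element that eventually
lies in `P`. By Krein-Milman it can be replaced by a pure state with at least the same value at
`b⋆b`, and the kernel of its GNS representation is a primitive ideal to which the ultrafilter
converges.

Hence `Prim(A)` is locally compact. If `q_A` is open then `(Glimm(A), τ_q)` is a locally compact
Hausdorff space, therefore completely regular, and so `τ_q = τ_cr`. A compact `K` is then covered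
by the open sets `q_A {P | 1 < ‖b⋆b + P‖}`. These are directed, because `b⋆b + c⋆c` is again of the
form `d⋆d`, so one `b` suffices, and `‖b⋆b + G‖ ≥ ‖b⋆b + P‖` for `G ⊆ P`.

If `A` is quasi-standard, the graph of `∼` is the closure of the diagonal, so `Prim(A)/∼` is
likewise locally compact Hausdorff and its continuous functions separate points. This gives
`∼ = ≈`, which is open by assumption.
-/

namespace CStarGlimm

universe u

open Filter Topology Set Metric UniformSpace
open scoped ComplexOrder InnerProductSpace

section Representations

variable {A : Type*} [NonUnitalCStarAlgebra A] {H : Type*} [NormedAddCommGroup H]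
  [InnerProductSpace ℂ H] [CompleteSpace H] (π : A →⋆ₙₐ[ℂ] (H →L[ℂ] H))

theorem inner_map_star_apply (a : A) (x y : H) : ⟪x, π (star a) y⟫_ℂ = ⟪π a x, y⟫_ℂ := by
  rw [map_star, ContinuousLinearMap.star_eq_adjoint, ContinuousLinearMap.adjoint_inner_right]

theorem norm_inner_map_apply_le (a : A) (v : H) : ‖⟪v, π a v⟫_ℂ‖ ≤ ‖v‖ ^ 2 * ‖a‖ := by
  have h : ‖π a v‖ ≤ ‖a‖ * ‖v‖ :=
    (π a).le_of_opNorm_le (NonUnitalStarAlgHom.norm_apply_le π a) v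
  calc ‖⟪v, π a v⟫_ℂ‖ ≤ ‖v‖ * ‖π a v‖ := norm_inner_le_norm _ _
    _ ≤ ‖v‖ * (‖a‖ * ‖v‖) := by gcongr
    _ = ‖v‖ ^ 2 * ‖a‖ := by ring

/-- The vector functional `a ↦ ⟪v, π a v⟫` of a representation. It is placed in the weak dual, where
the compactness arguments take place. -/
noncomputable def vectorFunctional (v : H) : WeakDual ℂ A :=
  StrongDual.toWeakDual <| LinearMap.mkContinuous
    { toFun := fun a => ⟪v, π a v⟫_ℂ
      map_add' := fun a b => by simp only [map_add, add_apply, inner_add_right]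
      map_smul' := fun c a => by
        simp only [map_smul, smul_apply, inner_smul_right, smul_eq_mul, RingHom.id_apply] }
    (‖v‖ ^ 2) fun a => norm_inner_map_apply_le π a v

@[simp]
theorem vectorFunctional_apply (v : H) (a : A) : vectorFunctional π v a = ⟪v, π a v⟫_ℂ := rfl

theorem norm_vectorFunctional_le (v : H) :
    ‖WeakDual.toStrongDual (vectorFunctional π v)‖ ≤ ‖v‖ ^ 2 :=
  LinearMap.mkContinuous_norm_le _ (sq_nonneg ‖v‖) fun a =>
    norm_inner_map_apply_le π a v

theorem vectorFunctional_star_mul_self (v : H) (a : A) :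
    vectorFunctional π v (star a * a) = ((‖π a v‖ ^ 2 : ℝ) : ℂ) := by
  rw [vectorFunctional_apply, map_mul, mul_apply_eq_comp, inner_map_star_apply,
    inner_self_eq_norm_sq_to_K]
  norm_cast

variable {π} {M : Submodule ℂ H}

theorem map_mem_orthogonal (hM : ∀ a : A, ∀ v ∈ M, π a v ∈ M) (a : A) {w : H} (hw : w ∈ Mᗮ) :
    π a w ∈ Mᗮ := by
  refine (Submodule.mem_orthogonal _ _).2 fun m hm => ?_
  rw [← star_star a, inner_map_star_apply]
  exact (Submodule.mem_orthogonal _ _).1 hw _ (hM _ _ hm)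

theorem eq_top_of_cyclic_mem (hM : ∀ a : A, ∀ v ∈ M, π a v ∈ M) (hMc : IsClosed (M : Set H))
    {ξ : H} (hcyc : DenseRange fun a => π a ξ) (hξ : ξ ∈ M) : M = ⊤ :=
  Submodule.eq_top_iff'.2 fun x =>
    closure_minimal (range_subset_iff.2 fun a => hM a ξ hξ) hMc (hcyc x)

theorem inner_apply_add_of_mem_orthogonal (hM : ∀ a : A, ∀ v ∈ M, π a v ∈ M) {v w : H} (hv : v ∈ M)
    (hw : w ∈ Mᗮ) (a : A) : ⟪v, π a (v + w)⟫_ℂ = vectorFunctional π v a := by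
  rw [map_add, inner_add_right, Submodule.inner_right_of_mem_orthogonal hv
    (map_mem_orthogonal hM a hw), add_zero, vectorFunctional_apply]

theorem vectorFunctional_add_of_mem_orthogonal (hM : ∀ a : A, ∀ v ∈ M, π a v ∈ M) {v w : H}
    (hv : v ∈ M) (hw : w ∈ Mᗮ) :
    vectorFunctional π (v + w) = vectorFunctional π v + vectorFunctional π w := by
  refine DFunLike.ext _ _ fun a => ?_
  change ⟪v + w, π a (v + w)⟫_ℂ = vectorFunctional π v a + vectorFunctional π w a
  rw [inner_add_left, inner_apply_add_of_mem_orthogonal hM hv hw, map_add, inner_add_right,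
    Submodule.inner_left_of_mem_orthogonal (hM a v hv) hw, zero_add, vectorFunctional_apply π w]

theorem eq_smul_of_vectorFunctional_eq_smul (hM : ∀ a : A, ∀ v ∈ M, π a v ∈ M) {v w : H}
    (hv : v ∈ M) (hw : w ∈ Mᗮ) (hcyc : DenseRange fun a => π a (v + w)) {t : ℝ}
    (h : vectorFunctional π v = t • vectorFunctional π (v + w)) : v = (t : ℂ) • (v + w) := by
  refine hcyc.eq_of_inner_left ℂ fun a => ?_
  calc ⟪v, π a (v + w)⟫_ℂ = vectorFunctional π v a := inner_apply_add_of_mem_orthogonal hM hv hw a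
    _ = t • ⟪v + w, π a (v + w)⟫_ℂ := DFunLike.congr_fun h a
    _ = ⟪(t : ℂ) • (v + w), π a (v + w)⟫_ℂ := by
      rw [inner_smul_left, Complex.conj_ofReal, Complex.real_smul]

end Representations

section QuasiStates

variable {A : Type*} [NonUnitalCStarAlgebra A]

/-- The quasi-states of `A` that vanish on the ideal `J`: the positive functionals of norm at most
one that factor through `A / J`. Positivity is expressed by the values at the elements `a* a`, so
that no order on `A` has to be chosen. -/
def quasiStates (J : TwoSidedIdeal A) : Set (WeakDual ℂ A) :=
  {f | ‖WeakDual.toStrongDual f‖ ≤ 1 ∧ (∀ a, 0 ≤ f (star a * a)) ∧ ∀ x ∈ J, f x = 0}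

theorem quasiStates_anti : Antitone (quasiStates (A := A)) :=
  fun _ _ h _ hf => ⟨hf.1, hf.2.1, fun x hx => hf.2.2 x (h hx)⟩

theorem isCompact_quasiStates (J : TwoSidedIdeal A) : IsCompact (quasiStates J) := by
  have hpos : IsClosed {f : WeakDual ℂ A | ∀ a, 0 ≤ f (star a * a)} := by
    simp only [ofPred_forall]
    exact isClosed_iInter fun a => isClosed_le continuous_const (WeakDual.eval_continuous _)
  have hvan : IsClosed {f : WeakDual ℂ A | ∀ x ∈ J, f x = 0} := by
    simp only [ofPred_forall]
    exact isClosed_biInter fun x _ => isClosed_eq (WeakDual.eval_continuous x) continuous_const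
  convert (WeakDual.isCompact_closedBall (0 : StrongDual ℂ A) 1).inter_right (hpos.inter hvan)
    using 1
  ext f
  simp [quasiStates]

variable {H : Type*} [NormedAddCommGroup H] [InnerProductSpace ℂ H] [CompleteSpace H]
  {π : A →⋆ₙₐ[ℂ] (H →L[ℂ] H)} {J : TwoSidedIdeal A}

theorem smul_vectorFunctional_mem_quasiStates (hJ : J ≤ TwoSidedIdeal.ker π) {v : H} {r : ℝ}
    (hr : 0 ≤ r) (hrv : r * ‖v‖ ^ 2 ≤ 1) :
    r • vectorFunctional π v ∈ quasiStates J := by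
  refine ⟨?_, fun a => ?_, fun x hx => ?_⟩
  · calc ‖r • WeakDual.toStrongDual (vectorFunctional π v)‖
        = r * ‖WeakDual.toStrongDual (vectorFunctional π v)‖ := by
          rw [norm_smul, Real.norm_of_nonneg hr]
      _ ≤ r * ‖v‖ ^ 2 := by gcongr; exact norm_vectorFunctional_le π v
      _ ≤ 1 := hrv
  · change 0 ≤ r • vectorFunctional π v (star a * a)
    rw [vectorFunctional_star_mul_self]
    exact smul_nonneg hr (Complex.zero_le_real.2 (sq_nonneg _))
  · change r • ⟪v, π x v⟫_ℂ = 0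
    rw [(TwoSidedIdeal.mem_ker π).1 (hJ hx), zero_apply, inner_zero_right, smul_zero]

theorem vectorFunctional_mem_quasiStates (hJ : J ≤ TwoSidedIdeal.ker π) {v : H} (hv : ‖v‖ ≤ 1) :
    vectorFunctional π v ∈ quasiStates J := by
  have hv2 : 1 * ‖v‖ ^ 2 ≤ 1 := by rw [one_mul]; exact pow_le_one₀ (norm_nonneg v) hv
  exact one_smul ℝ (vectorFunctional π v) ▸ smul_vectorFunctional_mem_quasiStates hJ zero_le_one hv2

theorem exists_mem_quasiStates_norm_map_le (π : A →⋆ₙₐ[ℂ] (H →L[ℂ] H)) (b : A) :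
    ∃ f ∈ quasiStates (TwoSidedIdeal.ker π), ‖π (star b * b)‖ ≤ (f (star b * b)).re := by
  have hzero : vectorFunctional π 0 ∈ quasiStates (TwoSidedIdeal.ker π) :=
    vectorFunctional_mem_quasiStates le_rfl (by simp)
  obtain ⟨f, hf, hmax⟩ := (isCompact_quasiStates (TwoSidedIdeal.ker π)).exists_isMaxOn ⟨_, hzero⟩
    (Complex.continuous_re.comp (WeakDual.eval_continuous (star b * b))).continuousOn
  refine ⟨f, hf, ?_⟩
  rw [map_mul, map_star, CStarRing.norm_star_mul_self]
  by_contra! hlt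
  have hsqrt : √(f (star b * b)).re < ‖π b‖ := by
    simpa only [Real.sqrt_mul_self (norm_nonneg _)] using Real.sqrt_lt_sqrt (hf.2.1 b).1 hlt
  obtain ⟨v, hv, hbv⟩ := (π b).exists_lt_apply_of_lt_opNorm hsqrt
  have hle : (vectorFunctional π v (star b * b)).re ≤ (f (star b * b)).re :=
    hmax (vectorFunctional_mem_quasiStates le_rfl hv.le)
  rw [vectorFunctional_star_mul_self, Complex.ofReal_re] at hle
  exact hle.not_gt (Real.lt_sq_of_sqrt_lt hbv)

end QuasiStates

section GNS

theorem exists_inner_eq_of_norm_le {𝕜 E F : Type*} [RCLike 𝕜] [AddCommGroup E] [Module 𝕜 E]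
    [NormedAddCommGroup F] [InnerProductSpace 𝕜 F] [CompleteSpace F] {e : E →ₗ[𝕜] F}
    (he : DenseRange e) {l : E →ₗ[𝕜] 𝕜} {C : ℝ} (hC : 0 ≤ C) (hl : ∀ x, ‖l x‖ ≤ C * ‖e x‖) :
    ∃ ξ : F, ‖ξ‖ ≤ C ∧ ∀ x, inner 𝕜 ξ (e x) = l x := by
  refine ⟨(InnerProductSpace.toDual 𝕜 F).symm (l.extendOfNorm e), ?_, fun x => ?_⟩
  · rw [LinearIsometryEquiv.norm_map]
    exact LinearMap.opNorm_extendOfNorm_le he hC hl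
  · rw [InnerProductSpace.toDual_symm_apply]
    exact LinearMap.extendOfNorm_eq he ⟨C, hl⟩ x

variable {A : Type*} [NonUnitalCStarAlgebra A] [PartialOrder A] [StarOrderedRing A]
  (φ : A →ₚ[ℂ] ℂ)

theorem norm_sq_apply_star_mul_le (a b : A) :
    ‖φ (star a * b)‖ ^ 2 ≤ (φ (star a * a)).re * (φ (star b * b)).re := by
  have hnorm : ∀ c : A, ‖φ.toPreGNS c‖ ^ 2 = (φ (star c * c)).re := fun c => by
    exact_mod_cast congrArg Complex.re (φ.preGNS_norm_sq (φ.toPreGNS c))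
  rw [← hnorm, ← hnorm, ← mul_pow]
  gcongr
  exact norm_inner_le_norm (𝕜 := ℂ) (φ.toPreGNS a) (φ.toPreGNS b)

theorem norm_sq_apply_le {C : ℝ} (hC : 0 ≤ C) (hφ : ∀ a, ‖φ a‖ ≤ C * ‖a‖) (a : A) :
    ‖φ a‖ ^ 2 ≤ C * (φ (star a * a)).re := by
  have happrox := CStarAlgebra.increasingApproximateUnit A
  have hcont : Continuous φ := AddMonoidHomClass.continuous_of_bound φ C hφ
  refine le_of_tendsto (((hcont.tendsto a).comp (happrox.tendsto_mul_right a)).norm.pow 2) ?_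
  filter_upwards [happrox.eventually_norm, happrox.eventually_star_eq] with e he hstar
  have hunit : (φ (star e * e)).re ≤ C :=
    calc (φ (star e * e)).re ≤ ‖φ (star e * e)‖ := Complex.re_le_norm _
      _ ≤ C * ‖star e * e‖ := hφ _
      _ ≤ C * 1 := by
        rw [CStarRing.norm_star_mul_self]
        gcongr
        exact mul_le_one₀ he (norm_nonneg e) he
      _ = C := mul_one C
  have hnonneg : 0 ≤ (φ (star a * a)).re := (φ.map_nonneg (star_mul_self_nonneg a)).1
  calc ‖φ (e * a)‖ ^ 2 = ‖φ (star e * a)‖ ^ 2 := by rw [hstar]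
    _ ≤ (φ (star e * e)).re * (φ (star a * a)).re := norm_sq_apply_star_mul_le φ e a
    _ ≤ C * (φ (star a * a)).re := by gcongr

theorem exists_gns_inner_eq {C : ℝ} (hC : 0 ≤ C) (hφ : ∀ a, ‖φ a‖ ≤ C * ‖a‖) :
    ∃ ξ : φ.GNS, ‖ξ‖ ≤ √C ∧ ∀ a : A, ⟪ξ, (φ.toPreGNS a : φ.GNS)⟫_ℂ = φ a := by
  refine exists_inner_eq_of_norm_le
    (e := (Completion.toComplL (𝕜 := ℂ) (E := φ.PreGNS)).toLinearMap ∘ₗ φ.toPreGNS.toLinearMap)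
    (l := φ.toLinearMap) (Completion.denseRange_coe (α := φ.PreGNS)) (Real.sqrt_nonneg C)
    fun a => ?_
  change ‖φ a‖ ≤ √C * ‖(φ.toPreGNS a : φ.GNS)‖
  rw [Completion.norm_coe, φ.preGNS_norm_def, ← Real.sqrt_mul hC]
  exact Real.le_sqrt_of_sq_le (norm_sq_apply_le φ hC hφ _)

variable {φ} in
theorem gns_apply_eq_coe {ξ : φ.GNS} (hξ : ∀ a : A, ⟪ξ, (φ.toPreGNS a : φ.GNS)⟫_ℂ = φ a) (a : A) :
    φ.gnsNonUnitalStarAlgHom a ξ = (φ.toPreGNS a : φ.GNS) := by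
  refine ext_inner_right ℂ fun y => ?_
  induction y using Completion.induction_on with
  | hp => apply isClosed_eq <;> fun_prop
  | ih y =>
    rw [← inner_map_star_apply, φ.gnsNonUnitalStarAlgHom_apply_coe, Completion.inner_coe,
      φ.preGNS_inner_def]
    exact hξ (star a * φ.ofPreGNS y)

theorem le_ker_gns {J : TwoSidedIdeal A} (hJ : ∀ x ∈ J, φ x = 0) :
    J ≤ TwoSidedIdeal.ker φ.gnsNonUnitalStarAlgHom := fun x hx => by
  refine (TwoSidedIdeal.mem_ker _).2 (ContinuousLinearMap.ext fun y => ?_)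
  induction y using Completion.induction_on with
  | hp => apply isClosed_eq <;> fun_prop
  | ih y =>
    rw [φ.gnsNonUnitalStarAlgHom_apply_coe, zero_apply, ← norm_eq_zero, Completion.norm_coe,
      φ.preGNS_norm_def, hJ]
    · simp
    · exact J.mul_mem_left _ _ (J.mul_mem_right _ _ hx)

end GNS

section PureStates

theorem exists_mem_extremePoints_forall_le {E : Type*} [AddCommGroup E] [Module ℝ E]
    [TopologicalSpace E] [T2Space E] [IsTopologicalAddGroup E] [ContinuousSMul ℝ E]
    [LocallyConvexSpace ℝ E] {S : Set E} (hS : IsCompact S) (hne : S.Nonempty) (l : E →L[ℝ] ℝ) :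
    ∃ x ∈ S.extremePoints ℝ, ∀ y ∈ S, l y ≤ l x := by
  have hface : IsExposed ℝ S (l.toExposed S) := ContinuousLinearMap.toExposed.isExposed
  obtain ⟨m, hm, hmax⟩ := hS.exists_isMaxOn hne l.continuous.continuousOn
  obtain ⟨x, hx⟩ := (hface.isCompact hS).extremePoints_nonempty ⟨m, hm, fun y hy => hmax hy⟩
  exact ⟨x, hface.isExtreme.extremePoints_subset_extremePoints hx, (extremePoints_subset hx).2⟩

theorem exists_cyclic_representation {A : Type u} [NonUnitalCStarAlgebra A] {J : TwoSidedIdeal A}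
    {f : WeakDual ℂ A} (hf : f ∈ quasiStates J) :
    ∃ (H : Type u) (_ : NormedAddCommGroup H) (_ : InnerProductSpace ℂ H) (_ : CompleteSpace H)
      (π : A →⋆ₙₐ[ℂ] (H →L[ℂ] H)) (ξ : H), J ≤ TwoSidedIdeal.ker π ∧ ‖ξ‖ ≤ 1 ∧
        DenseRange (fun a => π a ξ) ∧ f = vectorFunctional π ξ := by
  let _ : PartialOrder A := CStarAlgebra.spectralOrder A
  have : StarOrderedRing A := CStarAlgebra.spectralOrderedRing A
  let φ : A →ₚ[ℂ] ℂ := PositiveLinearMap.mk₀ (WeakDual.toStrongDual f).toLinearMap fun a ha => by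
    obtain ⟨b, rfl⟩ := CStarAlgebra.nonneg_iff_eq_star_mul_self.1 ha
    exact hf.2.1 b
  have hφ : ∀ a, ‖φ a‖ ≤ 1 * ‖a‖ := (WeakDual.toStrongDual f).le_of_opNorm_le hf.1
  obtain ⟨ξ, hξ, hinner⟩ := exists_gns_inner_eq φ zero_le_one hφ
  refine ⟨φ.GNS, inferInstance, inferInstance, inferInstance, φ.gnsNonUnitalStarAlgHom, ξ,
    le_ker_gns φ hf.2.2, by rwa [Real.sqrt_one] at hξ, ?_, DFunLike.ext _ _ fun a => ?_⟩
  · simp only [gns_apply_eq_coe hinner]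
    exact Completion.denseRange_coe (α := φ.PreGNS)
  · rw [vectorFunctional_apply, gns_apply_eq_coe hinner, hinner]
    rfl

section Irreducible

variable {A : Type*} [NonUnitalCStarAlgebra A] {H : Type*} [NormedAddCommGroup H]
  [InnerProductSpace ℂ H] [CompleteSpace H] {π : A →⋆ₙₐ[ℂ] (H →L[ℂ] H)} {J : TwoSidedIdeal A}
  {M : Submodule ℂ H}

theorem vectorFunctional_eq_smul_of_mem_extremePoints (hJ : J ≤ TwoSidedIdeal.ker π)
    (hM : ∀ a : A, ∀ v ∈ M, π a v ∈ M) {v w : H} (hv : v ∈ M) (hw : w ∈ Mᗮ) (hv₀ : v ≠ 0)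
    (hw₀ : w ≠ 0) (hvw : ‖v + w‖ ≤ 1)
    (hext : vectorFunctional π (v + w) ∈ (quasiStates J).extremePoints ℝ) :
    vectorFunctional π v = (‖v‖ ^ 2) • vectorFunctional π (v + w) := by
  have hnorm : ‖v‖ ^ 2 + ‖w‖ ^ 2 ≤ 1 := by
    have h := norm_add_sq_eq_norm_sq_add_norm_sq_of_inner_eq_zero v w
      (Submodule.inner_right_of_mem_orthogonal hv hw)
    nlinarith [norm_nonneg (v + w)]
  set t := ‖v‖ ^ 2
  have ht : 0 < t := by positivity
  have ht' : 0 < 1 - t := by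
    have : 0 < ‖w‖ ^ 2 := by positivity
    linarith
  have hsmul {r : ℝ} (hr : 0 < r) (f : WeakDual ℂ A) : r • r⁻¹ • f = f := smul_inv_smul₀ hr.ne' f
  have hv_mem : t⁻¹ • vectorFunctional π v ∈ quasiStates J :=
    smul_vectorFunctional_mem_quasiStates hJ (by positivity) (inv_mul_cancel₀ ht.ne').le
  have hw_mem : (1 - t)⁻¹ • vectorFunctional π w ∈ quasiStates J :=
    smul_vectorFunctional_mem_quasiStates hJ (by positivity)
      ((inv_mul_le_one₀ ht').2 (by linarith))
  have hseg : vectorFunctional π (v + w) ∈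
      openSegment ℝ (t⁻¹ • vectorFunctional π v) ((1 - t)⁻¹ • vectorFunctional π w) := by
    refine ⟨t, 1 - t, ht, ht', by ring, ?_⟩
    rw [hsmul ht, hsmul ht', vectorFunctional_add_of_mem_orthogonal hM hv hw]
  have heq := (mem_extremePoints_iff_left.1 hext).2 _ hv_mem _ hw_mem hseg
  rw [← heq, hsmul ht]

theorem eq_bot_or_eq_top_of_mem_extremePoints (hJ : J ≤ TwoSidedIdeal.ker π) {ξ : H}
    (hξ : ‖ξ‖ ≤ 1) (hcyc : DenseRange fun a => π a ξ)
    (hext : vectorFunctional π ξ ∈ (quasiStates J).extremePoints ℝ)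
    (hMc : IsClosed (M : Set H)) (hM : ∀ a : A, ∀ v ∈ M, π a v ∈ M) : M = ⊥ ∨ M = ⊤ := by
  have : CompleteSpace M := hMc.completeSpace_coe
  obtain ⟨v, hv, w, hw, rfl⟩ := M.exists_add_mem_mem_orthogonal ξ
  have eq_top (hw₀ : w = 0) : M = ⊤ :=
    eq_top_of_cyclic_mem hM hMc hcyc (by rwa [hw₀, add_zero])
  have eq_bot (hv₀ : v = 0) : M = ⊥ := by
    rw [← Submodule.orthogonal_eq_top_iff]
    exact eq_top_of_cyclic_mem (fun a w hw => map_mem_orthogonal hM a hw) M.isClosed_orthogonal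
      hcyc (by rwa [hv₀, zero_add])
  by_cases hv₀ : v = 0
  · exact .inl (eq_bot hv₀)
  by_cases hw₀ : w = 0
  · exact .inr (eq_top hw₀)
  have hvt := eq_smul_of_vectorFunctional_eq_smul hM hv hw hcyc
    (vectorFunctional_eq_smul_of_mem_extremePoints hJ hM hv hw hv₀ hw₀ hξ hext)
  have hmem : v + w ∈ M := by
    have ht : ((‖v‖ ^ 2 : ℝ) : ℂ) ≠ 0 := by
      exact_mod_cast pow_ne_zero 2 (norm_ne_zero_iff.2 hv₀)
    rw [hvt] at hv
    exact (M.smul_mem_iff ht).1 hv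
  exact .inr (eq_top_of_cyclic_mem hM hMc hcyc hmem)

end Irreducible

variable {A : Type u} [NonUnitalCStarAlgebra A] {J : TwoSidedIdeal A}

theorem exists_primitive_of_mem_extremePoints {f : WeakDual ℂ A}
    (hf : f ∈ (quasiStates J).extremePoints ℝ) (hf₀ : f ≠ 0) :
    ∃ P : PrimSpace A, J ≤ P.1 ∧ f ∈ quasiStates P.1 := by
  obtain ⟨H, _, _, _, π, ξ, hJ, hξ, hcyc, rfl⟩ :=
    exists_cyclic_representation (extremePoints_subset hf)
  have hπ : ∃ a, π a ≠ 0 := by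
    by_contra! h
    exact hf₀ (DFunLike.ext _ _ fun a => by
      rw [vectorFunctional_apply, h, zero_apply, inner_zero_right]
      rfl)
  have hirr : IsIrreducibleRep π :=
    ⟨hπ, fun M hMc hM => eq_bot_or_eq_top_of_mem_extremePoints hJ hξ hcyc hf hMc hM⟩
  exact ⟨⟨TwoSidedIdeal.ker π, H, _, _, _, π, hirr, rfl⟩, hJ,
    vectorFunctional_mem_quasiStates le_rfl hξ⟩

theorem exists_primitive_of_re_apply_pos {f : WeakDual ℂ A} (hf : f ∈ quasiStates J) {a : A}
    (ha : 0 < (f a).re) :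
    ∃ P : PrimSpace A, J ≤ P.1 ∧ ∃ g ∈ quasiStates P.1, (f a).re ≤ (g a).re := by
  have : LocallyConvexSpace ℝ (WeakDual ℂ A) :=
    inferInstanceAs (LocallyConvexSpace ℝ (WeakBilin (topDualPairing ℂ A)))
  let reEval : WeakDual ℂ A →L[ℝ] ℝ :=
    { toFun := fun g => (g a).re
      map_add' := fun g h => Complex.add_re (g a) (h a)
      map_smul' := fun r g => Complex.smul_re r (g a)
      cont := Complex.continuous_re.comp (WeakDual.eval_continuous a) }
  obtain ⟨g, hg, hmax⟩ :=
    exists_mem_extremePoints_forall_le (isCompact_quasiStates J) ⟨f, hf⟩ reEval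
  have hfg : (f a).re ≤ (g a).re := hmax f hf
  have hg₀ : g ≠ 0 := by
    rintro rfl
    exact (ha.trans_le hfg).ne' Complex.zero_re
  obtain ⟨P, hJP, hgP⟩ := exists_primitive_of_mem_extremePoints hg hg₀
  exact ⟨P, hJP, g, hgP, hfg⟩

end PureStates

section SoftThreshold

/-- Soft thresholding: `t` moved by `r` towards `0`, and `0` if `|t| ≤ r`. The functional calculus
with this function detects whether the norm of a self-adjoint element is at most `r`. -/
noncomputable def softThreshold (r t : ℝ) : ℝ := t - max (-r) (min r t)

@[fun_prop]
theorem continuous_softThreshold (r : ℝ) : Continuous (softThreshold r) := by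
  unfold softThreshold
  fun_prop

theorem softThreshold_eq_zero_iff {r t : ℝ} (hr : 0 ≤ r) : softThreshold r t = 0 ↔ |t| ≤ r := by
  rw [softThreshold, sub_eq_zero, abs_le]
  grind

theorem softThreshold_zero {r : ℝ} (hr : 0 ≤ r) : softThreshold r 0 = 0 :=
  (softThreshold_eq_zero_iff hr).2 (by rwa [abs_zero])

theorem abs_sub_softThreshold_le {r : ℝ} (hr : 0 ≤ r) (t : ℝ) : |t - softThreshold r t| ≤ r := by
  rw [softThreshold, sub_sub_cancel, abs_le]
  exact ⟨le_max_left _ _, max_le (by linarith) (min_le_left r t)⟩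

variable {A : Type*} [NonUnitalCStarAlgebra A] {h : A} {r : ℝ}

theorem cfcₙ_softThreshold_eq_zero_iff (hh : IsSelfAdjoint h) (hr : 0 ≤ r) :
    cfcₙ (softThreshold r) h = 0 ↔ ‖h‖ ≤ r := by
  rw [← norm_le_zero_iff, norm_cfcₙ_le_iff (softThreshold r) h 0
    (hf₀ := softThreshold_zero hr)]
  nth_rw 2 [← cfcₙ_id' ℝ h]
  rw [norm_cfcₙ_le_iff (fun x : ℝ => x) h r]
  exact forall₂_congr fun x _ => by
    rw [norm_le_zero_iff, softThreshold_eq_zero_iff hr, Real.norm_eq_abs]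

theorem norm_sub_cfcₙ_softThreshold_le (hh : IsSelfAdjoint h) (hr : 0 ≤ r) :
    ‖h - cfcₙ (softThreshold r) h‖ ≤ r := by
  nth_rw 1 [← cfcₙ_id' ℝ h]
  rw [← cfcₙ_sub (fun x : ℝ => x) (softThreshold r) h (hg0 := softThreshold_zero hr)]
  exact norm_cfcₙ_le fun x _ => abs_sub_softThreshold_le hr x

theorem cfcₙ_softThreshold_mem_ker_iff {B : Type*} [NonUnitalCStarAlgebra B] (π : A →⋆ₙₐ[ℂ] B)
    (hh : IsSelfAdjoint h) (hr : 0 ≤ r) :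
    cfcₙ (softThreshold r) h ∈ TwoSidedIdeal.ker π ↔ ‖π h‖ ≤ r := by
  have hcont : Continuous π := AddMonoidHomClass.continuous_of_bound π 1 fun a => by
    rw [one_mul]
    exact NonUnitalStarAlgHom.norm_apply_le π a
  have hmap : π (cfcₙ (softThreshold r) h) = cfcₙ (softThreshold r) (π h) :=
    NonUnitalStarAlgHom.map_cfcₙ π (softThreshold r) h (hf₀ := softThreshold_zero hr)
      (hφa := hh.map π)
  rw [TwoSidedIdeal.mem_ker, hmap, cfcₙ_softThreshold_eq_zero_iff (hh.map π) hr]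

end SoftThreshold

section QuotientNorm

variable {A : Type*} [NonUnitalCStarAlgebra A] {J : TwoSidedIdeal A}

theorem quotientNorm_eq_infDist (a : A) (J : TwoSidedIdeal A) :
    quotientNorm a J = infDist a (J : Set A) := by
  rw [quotientNorm, QuotientAddGroup.norm_mk]
  rfl

theorem le_quotientNorm {a : A} {r : ℝ} (h : ∀ x ∈ J, r ≤ ‖a - x‖) : r ≤ quotientNorm a J := by
  rw [quotientNorm_eq_infDist, le_infDist ⟨0, zero_mem J⟩]
  exact fun x hx => (h x hx).trans_eq (dist_eq_norm a x).symm

theorem quotientNorm_le {a x : A} (hx : x ∈ J) : quotientNorm a J ≤ ‖a - x‖ := by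
  rw [quotientNorm_eq_infDist, ← dist_eq_norm]
  exact infDist_le_dist_of_mem hx

theorem quotientNorm_anti (a : A) : Antitone (quotientNorm a) :=
  fun _ _ h => le_quotientNorm fun _ hx => quotientNorm_le (h hx)

theorem norm_map_le_quotientNorm {B : Type*} [NonUnitalCStarAlgebra B] {π : A →⋆ₙₐ[ℂ] B}
    (hJ : J ≤ TwoSidedIdeal.ker π) (a : A) : ‖π a‖ ≤ quotientNorm a J :=
  le_quotientNorm fun x hx => by
    have hax : π (a - x) = π a := by
      rw [map_sub, (TwoSidedIdeal.mem_ker π).1 (hJ hx), sub_zero]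
    exact hax ▸ NonUnitalStarAlgHom.norm_apply_le π (a - x)

theorem norm_apply_le_quotientNorm {f : WeakDual ℂ A} (hf : f ∈ quasiStates J) (a : A) :
    ‖f a‖ ≤ quotientNorm a J :=
  le_quotientNorm fun x hx => by
    have hax : f (a - x) = f a := by rw [map_sub, hf.2.2 x hx, sub_zero]
    calc ‖f a‖ = ‖f (a - x)‖ := by rw [hax]
      _ ≤ 1 * ‖a - x‖ := (WeakDual.toStrongDual f).le_of_opNorm_le hf.1 (a - x)
      _ = ‖a - x‖ := one_mul _

variable {h : A}

theorem quotientNorm_ker {B : Type*} [NonUnitalCStarAlgebra B] (π : A →⋆ₙₐ[ℂ] B)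
    (hh : IsSelfAdjoint h) : quotientNorm h (TwoSidedIdeal.ker π) = ‖π h‖ :=
  le_antisymm
    ((quotientNorm_le ((cfcₙ_softThreshold_mem_ker_iff π hh (norm_nonneg _)).2 le_rfl)).trans
      (norm_sub_cfcₙ_softThreshold_le hh (norm_nonneg _)))
    (norm_map_le_quotientNorm le_rfl h)

theorem quotientNorm_le_quotientNorm_ker_of_le [PartialOrder A] [StarOrderedRing A] {B : Type*}
    [NonUnitalCStarAlgebra B] (π : A →⋆ₙₐ[ℂ] B) {k : A} (hh : 0 ≤ h) (hhk : h ≤ k) :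
    quotientNorm h (TwoSidedIdeal.ker π) ≤ quotientNorm k (TwoSidedIdeal.ker π) := by
  let _ : PartialOrder B := CStarAlgebra.spectralOrder B
  have : StarOrderedRing B := CStarAlgebra.spectralOrderedRing B
  rw [quotientNorm_ker π (.of_nonneg hh), quotientNorm_ker π (.of_nonneg (hh.trans hhk))]
  exact CStarAlgebra.norm_le_norm_of_nonneg_of_le (map_nonneg π hh) (OrderHomClass.mono π hhk)

end QuotientNorm

section Spectrum

variable {A : Type u} [NonUnitalCStarAlgebra A]

theorem isOpen_notMem (x : A) : IsOpen {P : PrimSpace A | x ∉ P.1} := by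
  rw [← isClosed_compl_iff, isClosed_iff_hull]
  refine ⟨TwoSidedIdeal.span {x}, Set.ext fun P => ?_⟩
  simp [hull, TwoSidedIdeal.span_le]

theorem lt_quotientNorm_iff_cfcₙ_softThreshold_notMem {h : A} (hh : IsSelfAdjoint h) {r : ℝ}
    (hr : 0 ≤ r) (P : PrimSpace A) :
    r < quotientNorm h P.1 ↔ cfcₙ (softThreshold r) h ∉ P.1 := by
  obtain ⟨H, _, _, _, π, -, hP⟩ := P.2
  rw [hP, quotientNorm_ker π hh, cfcₙ_softThreshold_mem_ker_iff π hh hr, not_le]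

theorem isOpen_setOf_lt_quotientNorm {h : A} (hh : IsSelfAdjoint h) {r : ℝ} (hr : 0 ≤ r) :
    IsOpen {P : PrimSpace A | r < quotientNorm h P.1} := by
  simp only [lt_quotientNorm_iff_cfcₙ_softThreshold_notMem hh hr]
  exact isOpen_notMem _

theorem exists_mem_quasiStates_quotientNorm_le (P : PrimSpace A) (b : A) :
    ∃ f ∈ quasiStates P.1, quotientNorm (star b * b) P.1 ≤ (f (star b * b)).re := by
  obtain ⟨H, _, _, _, π, -, hP⟩ := P.2
  rw [hP, quotientNorm_ker π (.star_mul_self b)]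
  exact exists_mem_quasiStates_norm_map_le π b

/-- The ideal of the elements that eventually lie in `P` as `P` runs along a filter. A limit along
the filter of quasi-states, each vanishing on its `P`, vanishes on this ideal. -/
def eventualIdeal (l : Filter (PrimSpace A)) : TwoSidedIdeal A :=
  .mk' {x | ∀ᶠ P in l, x ∈ P.1} (by simp)
    (fun hx hy => by filter_upwards [hx, hy] with P h h' using P.1.add_mem h h')
    (fun hx => by filter_upwards [hx] with P h using P.1.neg_mem h)
    (fun hx => by filter_upwards [hx] with P h using P.1.mul_mem_left _ _ h)
    (fun hx => by filter_upwards [hx] with P h using P.1.mul_mem_right _ _ h)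

theorem mem_eventualIdeal {l : Filter (PrimSpace A)} {x : A} :
    x ∈ eventualIdeal l ↔ ∀ᶠ P in l, x ∈ P.1 :=
  TwoSidedIdeal.mem_mk' _ _ _ _ _ _ _

theorem le_nhds_of_eventualIdeal_le {l : Ultrafilter (PrimSpace A)} {P : PrimSpace A}
    (h : eventualIdeal (l : Filter (PrimSpace A)) ≤ P.1) : (l : Filter (PrimSpace A)) ≤ 𝓝 P := by
  refine le_nhds_iff.2 fun U hPU hU => ?_
  by_contra hUl
  obtain ⟨I, hI⟩ := isClosed_iff_hull.1 hU.isClosed_compl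
  have hl : hull I ∈ l := hI ▸ Ultrafilter.compl_mem_iff_notMem.2 hUl
  have hIl : I ≤ eventualIdeal (l : Filter (PrimSpace A)) := fun x hx =>
    mem_eventualIdeal.2 (by filter_upwards [hl] with Q hQ using hQ hx)
  have hP : P ∈ Uᶜ := hI ▸ hIl.trans h
  exact hP hPU

theorem exists_mem_quasiStates_eventualIdeal_tendsto {l : Ultrafilter (PrimSpace A)}
    {F : PrimSpace A → WeakDual ℂ A} (hF : ∀ P, F P ∈ quasiStates P.1) :
    ∃ f ∈ quasiStates (eventualIdeal (l : Filter (PrimSpace A))), Tendsto F l (𝓝 f) := by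
  obtain ⟨f, hf, hlim⟩ := (isCompact_quasiStates (⊥ : TwoSidedIdeal A)).ultrafilter_le_nhds'
    (l.map F) (Ultrafilter.mem_map.2 (univ_mem' fun P => quasiStates_anti bot_le (hF P)))
  refine ⟨f, ⟨hf.1, hf.2.1, fun x hx => ?_⟩, hlim⟩
  have hFx : (fun P => F P x) =ᶠ[l] fun _ => 0 := by
    filter_upwards [mem_eventualIdeal.1 hx] with P hxP using (hF P).2.2 x hxP
  exact tendsto_nhds_unique_of_eventuallyEq
    (((WeakDual.eval_continuous x).tendsto f).comp hlim) tendsto_const_nhds hFx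

theorem isCompact_setOf_le_quotientNorm (b : A) {r : ℝ} (hr : 0 < r) :
    IsCompact {P : PrimSpace A | r ≤ quotientNorm (star b * b) P.1} := by
  refine isCompact_iff_ultrafilter_le_nhds'.2 fun l hl => ?_
  choose F hF hnorm using fun P : PrimSpace A => exists_mem_quasiStates_quotientNorm_le P b
  obtain ⟨f, hf, hlim⟩ := exists_mem_quasiStates_eventualIdeal_tendsto (l := l) hF
  have hfb : r ≤ (f (star b * b)).re := by
    refine ge_of_tendsto (((Complex.continuous_re.comp
      (WeakDual.eval_continuous (star b * b))).tendsto f).comp hlim) ?_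
    filter_upwards [hl] with P hP using hP.trans (hnorm P)
  obtain ⟨P, hJP, g, hg, hfg⟩ := exists_primitive_of_re_apply_pos hf (hr.trans_le hfb)
  refine ⟨P, ?_, le_nhds_of_eventualIdeal_le hJP⟩
  calc r ≤ (g (star b * b)).re := hfb.trans hfg
    _ ≤ ‖g (star b * b)‖ := Complex.re_le_norm _
    _ ≤ quotientNorm (star b * b) P.1 := norm_apply_le_quotientNorm hg _

theorem exists_one_lt_quotientNorm (P : PrimSpace A) :
    ∃ b : A, 1 < quotientNorm (star b * b) P.1 := by
  obtain ⟨H, _, _, _, π, ⟨⟨c, hc⟩, -⟩, hP⟩ := P.2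
  have hc' : ‖π c‖ ≠ 0 := norm_ne_zero_iff.2 hc
  refine ⟨((2 / ‖π c‖ : ℝ) : ℂ) • c, ?_⟩
  rw [hP, quotientNorm_ker π (.star_mul_self _), map_mul, map_star, CStarRing.norm_star_mul_self,
    map_smul, norm_smul, Complex.norm_real, norm_div, norm_norm, div_mul_cancel₀ _ hc']
  norm_num

instance : WeaklyLocallyCompactSpace (PrimSpace A) where
  exists_compact_mem_nhds P := by
    obtain ⟨b, hb⟩ := exists_one_lt_quotientNorm P
    have hU := isOpen_setOf_lt_quotientNorm (.star_mul_self b) zero_le_one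
    exact ⟨_, isCompact_setOf_le_quotientNorm b one_pos,
      mem_of_superset (hU.mem_nhds hb) fun Q (hQ : 1 < quotientNorm _ Q.1) => hQ.le⟩

end Spectrum

section Topology

variable {X Y : Type*} [TopologicalSpace X] [TopologicalSpace Y]

theorem t35Space_of_weaklyLocallyCompactSpace [T2Space X] [WeaklyLocallyCompactSpace X] :
    T35Space X :=
  have : CompletelyRegularSpace X :=
    OnePoint.isOpenEmbedding_coe.isInducing.completelyRegularSpace
  {}

theorem t35Space_of_isOpenQuotientMap [WeaklyLocallyCompactSpace X] {q : X → Y}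
    (hq : IsOpenQuotientMap q) (hgraph : IsClosed {p : X × X | q p.1 = q p.2}) : T35Space Y :=
  have : WeaklyLocallyCompactSpace Y := hq.weaklyLocallyCompactSpace
  have : T2Space Y := (t2Space_iff_of_isOpenQuotientMap hq).2 hgraph
  t35Space_of_weaklyLocallyCompactSpace

theorem exists_boundedContinuousFunction_eq_zero_eqOn_one [CompletelyRegularSpace X] {x : X}
    {C : Set X} (hC : IsClosed C) (hx : x ∉ C) : ∃ f : X →ᵇ ℝ, f x = 0 ∧ EqOn f 1 C := by
  obtain ⟨f, hf, hfx, hfC⟩ := CompletelyRegularSpace.completely_regular x C hC hx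
  let coe : unitInterval →ᵇ ℝ := .mkOfCompact ⟨Subtype.val, continuous_subtype_val⟩
  exact ⟨coe.compContinuous ⟨f, hf⟩, congrArg coe hfx, fun y hy => congrArg coe (hfC hy)⟩

theorem exists_boundedContinuousFunction_ne [T35Space X] {x y : X} (hxy : x ≠ y) :
    ∃ f : X →ᵇ ℝ, f x ≠ f y := by
  obtain ⟨f, hfx, hfy⟩ :=
    exists_boundedContinuousFunction_eq_zero_eqOn_one (isClosed_singleton (x := y)) hxy
  exact ⟨f, by simp [hfx, hfy rfl]⟩

theorem iInf_induced_boundedContinuousFunction_le [CompletelyRegularSpace X] :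
    ⨅ f : X →ᵇ ℝ, TopologicalSpace.induced f inferInstance ≤ ‹TopologicalSpace X› := by
  refine le_of_nhds_le_nhds fun x U hU => ?_
  obtain ⟨V, hVU, hV, hxV⟩ := mem_nhds_iff.1 hU
  obtain ⟨f, hfx, hfV⟩ :=
    exists_boundedContinuousFunction_eq_zero_eqOn_one hV.isClosed_compl (not_not_intro hxV)
  have hf : f ⁻¹' Iio 1 ⊆ U := fun y hy => hVU (by_contra fun hyV => hy.ne (hfV hyV))
  refine nhds_mono (iInf_le _ f) (mem_of_superset ?_ hf)
  rw [nhds_induced]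
  exact preimage_mem_comap (Iio_mem_nhds (hfx.trans_lt one_pos))

theorem isOpenMap_quotientMk_iff {r : Setoid X} :
    IsOpenMap (Quotient.mk r) ↔ ∀ U : Set X, IsOpen U → IsOpen {y | ∃ x ∈ U, r x y} := by
  refine forall₂_congr fun U _ => ?_
  have hsat : Quotient.mk r ⁻¹' (Quotient.mk r '' U) = {y | ∃ x ∈ U, r x y} := by
    simp only [image, preimage, mem_ofPred_eq, Quotient.eq]
  rw [← hsat]
  exact isQuotientMap_quotient_mk'.isOpen_preimage.symm

theorem t35Space_quotient [WeaklyLocallyCompactSpace X] {r : Setoid X}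
    (hopen : IsOpenMap (Quotient.mk r)) (hgraph : IsClosed {p : X × X | r p.1 p.2}) :
    T35Space (Quotient r) :=
  t35Space_of_isOpenQuotientMap ⟨Quotient.mk_surjective, continuous_quotient_mk', hopen⟩
    (by simpa only [Quotient.eq] using hgraph)

end Topology

section Glimm

variable {A : Type u} [NonUnitalCStarAlgebra A]

theorem isClosed_setOf_glimmSetoid :
    IsClosed {p : PrimSpace A × PrimSpace A | glimmSetoid A p.1 p.2} := by
  have : {p : PrimSpace A × PrimSpace A | glimmSetoid A p.1 p.2} =
      ⋂ f : PrimSpace A →ᵇ ℝ, {p | f p.1 = f p.2} := by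
    ext p
    simp only [mem_iInter]
    rfl
  rw [this]
  exact isClosed_iInter fun f =>
    isClosed_eq (f.continuous.comp continuous_fst) (f.continuous.comp continuous_snd)

theorem tauQ_le_tauCR : tauQ A ≤ tauCR A :=
  le_iInf fun f => continuous_iff_le_induced.1 (continuous_coinduced_dom.2 f.continuous)

theorem tauQ_eq_tauCR
    (hq : @IsOpenMap (PrimSpace A) (Glimm A) inferInstance (tauQ A) (glimmMap A)) :
    tauQ A = tauCR A := by
  refine tauQ_le_tauCR.antisymm ?_
  let _ : TopologicalSpace (Glimm A) := tauQ A
  have : T35Space (Glimm A) := t35Space_quotient hq isClosed_setOf_glimmSetoid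
  refine (le_iInf fun g : Glimm A →ᵇ ℝ => ?_).trans iInf_induced_boundedContinuousFunction_le
  let f : PrimSpace A →ᵇ ℝ := g.compContinuous ⟨glimmMap A, continuous_coinduced_rng⟩
  have hdrop : Glimm.drop f = g := funext fun G => Quotient.inductionOn G fun _ => rfl
  exact iInf_le_of_le f (hdrop ▸ le_rfl)

theorem ideal_glimmMap_le (P : PrimSpace A) : (glimmMap A P).ideal ≤ P.1 :=
  sInf_le ⟨P, rfl, rfl⟩

theorem directed_setOf_lt_quotientNorm (r : ℝ) :
    Directed (· ⊆ ·) fun b : A => {P : PrimSpace A | r < quotientNorm (star b * b) P.1} := by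
  intro b c
  let _ : PartialOrder A := CStarAlgebra.spectralOrder A
  have : StarOrderedRing A := CStarAlgebra.spectralOrderedRing A
  have hb : 0 ≤ star b * b := star_mul_self_nonneg b
  have hc : 0 ≤ star c * c := star_mul_self_nonneg c
  obtain ⟨d, hd⟩ := CStarAlgebra.nonneg_iff_eq_star_mul_self.1 (add_nonneg hb hc)
  have hle {k : A} (hk : 0 ≤ k) (hkd : k ≤ star d * d) (P : PrimSpace A) :
      quotientNorm k P.1 ≤ quotientNorm (star d * d) P.1 := by
    obtain ⟨H, _, _, _, π, -, hP⟩ := P.2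
    exact hP ▸ quotientNorm_le_quotientNorm_ker_of_le π hk hkd
  exact ⟨d, fun P hP => hP.trans_le (hle hb (hd ▸ le_add_of_nonneg_right hc) P),
    fun P hP => hP.trans_le (hle hc (hd ▸ le_add_of_nonneg_left hb) P)⟩

theorem exists_norm_bound_of_isOpenMap
    (hq : @IsOpenMap (PrimSpace A) (Glimm A) inferInstance (tauQ A) (glimmMap A))
    {K : Set (Glimm A)} (hK : @IsCompact (Glimm A) (tauCR A) K) :
    ∃ a : A, ∃ α : ℝ, 0 < α ∧ K ⊆ {G | α ≤ quotientNorm a G.ideal} := by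
  rw [← tauQ_eq_tauCR hq] at hK
  let _ : TopologicalSpace (Glimm A) := tauQ A
  let U (b : A) : Set (PrimSpace A) := {P | 1 < quotientNorm (star b * b) P.1}
  have hU (b : A) : IsOpen (U b) := isOpen_setOf_lt_quotientNorm (.star_mul_self b) zero_le_one
  have hcover : K ⊆ ⋃ b, glimmMap A '' U b := fun G _ => by
    induction G using Quotient.inductionOn with | _ P =>
    obtain ⟨b, hb⟩ := exists_one_lt_quotientNorm P
    exact mem_iUnion.2 ⟨b, P, hb, rfl⟩
  obtain ⟨b, hb⟩ := hK.elim_directed_cover _ (fun b => hq _ (hU b)) hcover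
    ((directed_setOf_lt_quotientNorm 1).mono_comp (g := image (glimmMap A)) _ fun _ _ => image_mono)
  refine ⟨star b * b, 1, one_pos, hb.trans ?_⟩
  rintro _ ⟨P, hP : 1 < quotientNorm (star b * b) P.1, rfl⟩
  exact hP.le.trans (quotientNorm_anti _ (ideal_glimmMap_le P))

theorem setOf_notSeparated_eq_closure_diagonal :
    {p : PrimSpace A × PrimSpace A | NotSeparated p.1 p.2} = closure (diagonal (PrimSpace A)) := by
  ext ⟨P, Q⟩
  rw [mem_closure_iff_nhds_basis' ((nhds_basis_opens P).prod_nhds (nhds_basis_opens Q))]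
  have hmeet {U V : Set (PrimSpace A)} :
      (U ×ˢ V ∩ diagonal (PrimSpace A)).Nonempty ↔ (U ∩ V).Nonempty := by
    rw [← not_disjoint_iff_nonempty_inter, ← not_disjoint_iff_nonempty_inter,
      ← subset_compl_iff_disjoint_right, prod_subset_compl_diagonal_iff_disjoint]
  exact ⟨fun h i hi => hmeet.2 (h _ _ hi.1.2 hi.2.2 hi.1.1 hi.2.1),
    fun h U V hU hV hP hQ => hmeet.1 (h (U, V) ⟨⟨hP, hU⟩, hQ, hV⟩)⟩

theorem IsQuasiStandard.isOpenMap_mk (hA : IsQuasiStandard A) :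
    IsOpenMap (Quotient.mk ⟨NotSeparated (A := A), hA.1⟩) :=
  isOpenMap_quotientMk_iff.2 hA.2

theorem IsQuasiStandard.eq_glimmSetoid (hA : IsQuasiStandard A) :
    ⟨NotSeparated, hA.1⟩ = glimmSetoid A := by
  let r : Setoid (PrimSpace A) := ⟨NotSeparated, hA.1⟩
  have hgraph : {p : PrimSpace A × PrimSpace A | r p.1 p.2} = closure (diagonal (PrimSpace A)) :=
    setOf_notSeparated_eq_closure_diagonal
  refine Setoid.ext fun P Q => ⟨fun hPQ => ?_, fun hPQ => ?_⟩
  · have hdiag : diagonal (PrimSpace A) ⊆ {p | glimmSetoid A p.1 p.2} := fun p hp f =>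
      congrArg f hp
    have hcl : (P, Q) ∈ closure (diagonal (PrimSpace A)) := hgraph.subset hPQ
    exact closure_minimal hdiag isClosed_setOf_glimmSetoid hcl
  · have : T35Space (Quotient r) := t35Space_quotient hA.isOpenMap_mk (hgraph ▸ isClosed_closure)
    by_contra hr
    obtain ⟨g, hg⟩ := exists_boundedContinuousFunction_ne
      (fun h => hr (Quotient.exact h) : (Quotient.mk r P) ≠ Quotient.mk r Q)
    exact hg (hPQ (g.compContinuous ⟨Quotient.mk r, continuous_quotient_mk'⟩))

theorem IsQuasiStandard.isOpenMap_glimmMap (hA : IsQuasiStandard A) :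
    @IsOpenMap (PrimSpace A) (Glimm A) inferInstance (tauQ A) (glimmMap A) := by
  have h := hA.isOpenMap_mk
  rw [hA.eq_glimmSetoid] at h
  exact h

end Glimm

end CStarGlimm

theorem mainTheorem4 {A : Type*} [NonUnitalCStarAlgebra A] :
    (@IsOpenMap (CStarGlimm.PrimSpace A) (CStarGlimm.Glimm A) inferInstance (CStarGlimm.tauQ A)
        (CStarGlimm.glimmMap A) →
      ∀ K : Set (CStarGlimm.Glimm A), @IsCompact (CStarGlimm.Glimm A) (CStarGlimm.tauCR A) K →
        ∃ a : A, ∃ α : ℝ, 0 < α ∧ K ⊆ {G | α ≤ CStarGlimm.quotientNorm a G.ideal}) ∧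
    (CStarGlimm.IsQuasiStandard A →
      @IsOpenMap (CStarGlimm.PrimSpace A) (CStarGlimm.Glimm A) inferInstance (CStarGlimm.tauQ A)
        (CStarGlimm.glimmMap A) ∧
      ∀ K : Set (CStarGlimm.Glimm A), @IsCompact (CStarGlimm.Glimm A) (CStarGlimm.tauCR A) K →
        ∃ a : A, ∃ α : ℝ, 0 < α ∧ K ⊆ {G | α ≤ CStarGlimm.quotientNorm a G.ideal}) :=
  ⟨fun hq _ hK => CStarGlimm.exists_norm_bound_of_isOpenMap hq hK,
    fun hA => ⟨hA.isOpenMap_glimmMap,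
      fun _ hK => CStarGlimm.exists_norm_bound_of_isOpenMap hA.isOpenMap_glimmMap hK⟩⟩
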